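/- Consider the real linear time-invariant system $\dot x = Ax + B_2u + B_1w$, $z = Cx + Du$ with $x\in\mathbb R^n$, $u\in\mathbb R^m$, $w\in\mathbb R^l$, $z\in\mathbb R^q$, where $[A,C]$ is observable, $C^TD=0$ and $D^TD\succ 0$. For a gain $K\in\mathbb R^{m\times n}$ and the state feedback $u=-Kx$ put $A_c=A-B_2K$, $C_c=C-DK$ and $H(s)=H_K(s)=C_c(sI-A_c)^{-1}B_1$; $K$ is called stabilizing if all eigenvalues of $A_c$ have negative real part, and $\|H\|_\infty=\sup_{\omega\in\mathbb R}\sigma_{\max}(H(j\omega))$. The optimal $\mathcal H_\infty$ state-feedback problem is to minimize $\|H_K\|_\infty$ over all stabilizing gains $K$. Let $$F=\begin{bmatrix}A&-B_2\\0&0\end{bmatrix},\quad Q=\begin{bmatrix}B_1B_1^T&0\\0&0\end{bmatrix},\quad R=\begin{bmatrix}C^TC&0\\0&D^TD\end{bmatrix},\quad W=W^T=\begin{bmatrix}W_1&W_2\\W_2^T&W_3\end{bmatrix}\in\mathbb R^{(n+m)\times(n+m)},$$ $\Theta(W,\mu)=FW+WF^T+WRW+\mu Q$, and let $\Theta_1(W,\mu)$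 be the upper left $n\times n$ block of $\Theta(W,\mu)$. Let $$\mathscr C=\{(W,\mu): W=W^T\succeq 0,\ W_1\succ 0,\ \Theta_1(W,\mu)\preceq 0,\ \mu>0\}.$$ Then: (a) $\mathscr C$ is convex. (b) For every $(W,\mu)\in\mathscr C$ the gain $K=W_2^TW_1^{-1}$ is stabilizing and $\|H_K\|_\infty\le\gamma$ with $\gamma=1/\sqrt\mu$. (c) Maximizing $\mu$ over $\mathscr C$ solves the optimal $\mathcal H_\infty$ state-feedback problem: if $(W^*,\mu^*)\in\mathscr C$ maximizes $\mu$ over $\mathscr C$, then $K^*=W_2^{*T}W_1^{*-1}$ is stabilizing and minimizes $\|H_K\|_\infty$ over all stabilizing $K$, and the minimal value is $\|H_{K^*}\|_\infty=\gamma^*=1/\sqrt{\mu^*}$. Moreover, whether or not a maximizer exists, $\inf\{\|H_K\|_\infty: K\text{ stabilizing}\}=\inf\{1/\sqrt\mu:(W,\mu)\in\mathscr C\}$ (both infima being $+\infty$ when there is no stabilizing gain). -/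

import Mathlib

open Matrix
open scoped ENNReal

/-- Data of the linear time-invariant system `ẋ = A x + B₂ u + B₁ w`, `z = C x + D u`, with
state in `ℝⁿ`, control input in `ℝᵐ`, disturbance in `ℝˡ` and controlled output in `ℝ^q`. -/
structure LTISystem (n m l q : ℕ) where
  A : Matrix (Fin n) (Fin n) ℝ
  B₁ : Matrix (Fin n) (Fin l) ℝ
  B₂ : Matrix (Fin n) (Fin m) ℝ
  C : Matrix (Fin q) (Fin n) ℝ
  D : Matrix (Fin q) (Fin m) ℝ

/-- A real square matrix is Hurwitz if all its complex eigenvalues have negative real part. -/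
def IsHurwitz {n : ℕ} (M : Matrix (Fin n) (Fin n) ℝ) : Prop :=
  ∀ z ∈ spectrum ℂ (M.map Complex.ofReal), z.re < 0

/-- Observability of the pair `[A, C]`: the matrix with block rows `C, CA, …, CAⁿ⁻¹` has
trivial kernel. -/
def IsObservablePair {n q : ℕ} (A : Matrix (Fin n) (Fin n) ℝ) (C : Matrix (Fin q) (Fin n) ℝ) :
    Prop :=
  ∀ x : Fin n → ℝ, (∀ k < n, (C * A ^ k) *ᵥ x = 0) → x = 0

/-- The largest singular value of a complex matrix, that is, its operator norm with respect to
the Euclidean norms. -/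
noncomputable def maxSingularValue {q l : ℕ} (M : Matrix (Fin q) (Fin l) ℂ) : ℝ :=
  ‖LinearMap.toContinuousLinearMap (Matrix.toEuclideanLin M)‖

namespace LTISystem

variable {n m l q : ℕ}

/-- The closed-loop state matrix `A - B₂ K` under the feedback `u = -K x`. -/
def closedLoopA (S : LTISystem n m l q) (K : Matrix (Fin m) (Fin n) ℝ) :
    Matrix (Fin n) (Fin n) ℝ :=
  S.A - S.B₂ * K

/-- The closed-loop output matrix `C - D K` under the feedback `u = -K x`. -/
def closedLoopC (S : LTISystem n m l q) (K : Matrix (Fin m) (Fin n) ℝ) :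
    Matrix (Fin q) (Fin n) ℝ :=
  S.C - S.D * K

/-- `K` is a stabilizing gain: the closed loop is asymptotically stable. -/
def IsStabilizing (S : LTISystem n m l q) (K : Matrix (Fin m) (Fin n) ℝ) : Prop :=
  IsHurwitz (S.closedLoopA K)

/-- The closed-loop transfer function `H(s) = (C - D K) (s I - (A - B₂ K))⁻¹ B₁` from `w` to `z`. -/
noncomputable def transferFunction (S : LTISystem n m l q) (K : Matrix (Fin m) (Fin n) ℝ)
    (s : ℂ) : Matrix (Fin q) (Fin l) ℂ :=
  (S.closedLoopC K).map Complex.ofReal *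
    (s • (1 : Matrix (Fin n) (Fin n) ℂ) - (S.closedLoopA K).map Complex.ofReal)⁻¹ *
    S.B₁.map Complex.ofReal

/-- The `H∞`-norm `sup_ω σ_max (H(jω))` of the closed loop, as an element of `[0, ∞]`. -/
noncomputable def hInfNorm (S : LTISystem n m l q) (K : Matrix (Fin m) (Fin n) ℝ) : ℝ≥0∞ :=
  ⨆ ω : ℝ, ENNReal.ofReal (maxSingularValue (S.transferFunction K (Complex.I * (ω : ℂ))))

/-- `K` solves the optimal `H∞` state-feedback problem: it minimizes the `H∞`-norm of the closed
loop among all stabilizing gains. -/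
def IsOptimalHInfGain (S : LTISystem n m l q) (K : Matrix (Fin m) (Fin n) ℝ) : Prop :=
  S.IsStabilizing K ∧ ∀ K', S.IsStabilizing K' → S.hInfNorm K ≤ S.hInfNorm K'

/-- The optimal value of the `H∞` state-feedback problem (`∞` if there is no stabilizing gain). -/
noncomputable def optimalHInfValue (S : LTISystem n m l q) : ℝ≥0∞ :=
  ⨅ (K : Matrix (Fin m) (Fin n) ℝ) (_ : S.IsStabilizing K), S.hInfNorm K

/-- The extended matrix `F = [A, -B₂; 0, 0]`. -/
def extF (S : LTISystem n m l q) : Matrix (Fin n ⊕ Fin m) (Fin n ⊕ Fin m) ℝ :=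
  fromBlocks S.A (-S.B₂) 0 0

/-- The extended matrix `Q = [B₁ B₁ᵀ, 0; 0, 0]`. -/
def extQ (S : LTISystem n m l q) : Matrix (Fin n ⊕ Fin m) (Fin n ⊕ Fin m) ℝ :=
  fromBlocks (S.B₁ * S.B₁ᵀ) 0 0 0

/-- The extended matrix `R = [Cᵀ C, 0; 0, Dᵀ D]`. -/
def extR (S : LTISystem n m l q) : Matrix (Fin n ⊕ Fin m) (Fin n ⊕ Fin m) ℝ :=
  fromBlocks (S.Cᵀ * S.C) 0 0 (S.Dᵀ * S.D)

/-- The matrix function `Θ(W, μ) = F W + W Fᵀ + W R W + μ Q`. -/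
def theta (S : LTISystem n m l q) (W : Matrix (Fin n ⊕ Fin m) (Fin n ⊕ Fin m) ℝ) (μ : ℝ) :
    Matrix (Fin n ⊕ Fin m) (Fin n ⊕ Fin m) ℝ :=
  S.extF * W + W * S.extFᵀ + W * S.extR * W + μ • S.extQ

/-- The upper left `n × n` block `Θ₁(W, μ)` of `Θ(W, μ)`. -/
def theta₁ (S : LTISystem n m l q) (W : Matrix (Fin n ⊕ Fin m) (Fin n ⊕ Fin m) ℝ) (μ : ℝ) :
    Matrix (Fin n) (Fin n) ℝ :=
  (S.theta W μ).toBlocks₁₁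

/-- The parameter set `𝒞` of all pairs `(W, μ)` with `W = [W₁, W₂; W₂ᵀ, W₃]` symmetric positive
semidefinite with positive definite upper left block `W₁`, with `Θ₁(W, μ) ⪯ 0` and `μ > 0`. -/
def paramSet (S : LTISystem n m l q) :
    Set (Matrix (Fin n ⊕ Fin m) (Fin n ⊕ Fin m) ℝ × ℝ) :=
  {p | p.1.PosSemidef ∧ p.1.toBlocks₁₁.PosDef ∧ (-(S.theta₁ p.1 p.2)).PosSemidef ∧ 0 < p.2}

end LTISystem

/-- The gain `K = W₂ᵀ W₁⁻¹` generated by `W = [W₁, W₂; W₂ᵀ, W₃]`. -/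
noncomputable def gainOf {n m : ℕ} (W : Matrix (Fin n ⊕ Fin m) (Fin n ⊕ Fin m) ℝ) :
    Matrix (Fin m) (Fin n) ℝ :=
  W.toBlocks₁₂ᵀ * W.toBlocks₁₁⁻¹

/-!
For `W = [W₁, W₁ Kᵀ; K W₁, W₃]` the block `Θ₁(W, μ)` is the Riccati expression
`A_c W₁ + W₁ A_cᵀ + W₁ C_cᵀ C_c W₁ + μ B₁ B₁ᵀ` of the closed loop under `u = -K x`, because
`Cᵀ D = 0` (`theta₁_fromBlocks`). Hence every `(W, μ) ∈ 𝒞` gives a positive definite solution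
`P = W₁⁻¹` of the Riccati inequality `RiccatiLE` for the closed loop under `K = gainOf W`, and every
such solution arises this way. Convexity of `𝒞` is convexity of `W ↦ W R W` in the Loewner order.

A solution `P` makes `⟨x, P x⟩` a storage function. Testing the inequality on eigenvectors of `A_c`
gives stability (observability survives state feedback, as `Dᵀ D ≻ 0`), and testing it on
`jω x = A_c x + B₁ w` gives the bound `1 / √μ` on the transfer function. This is the inequality
`‖H_K‖ ≤ 1 / √μ`, and one half of the equality of the two infima.

The other half is the strict bounded real lemma: if `A_c` is Hurwitz and `‖H_K‖ < γ`, the Riccati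
inequality with `μ = γ⁻²` has a solution `P ≻ 0` (`IsHurwitz.exists_riccatiLE`). It is proved by
duality. Symmetric matrices `P` for which `|C x|² - γ² |w|² + 2 ⟨x, P (A x + B w)⟩` is negative
definite exist unless the Hahn–Banach theorem supplies a nonzero `Z ⪰ 0` that annihilates all forms
`⟨x, P (A x + B w)⟩` and is nonnegative on `|C x|² - γ² |w|²` (`exists_storage_of_freq_lt`). The
first block row of `Z` factors as `V [Vᵀ, N]`, and the first condition says that `(A V + B Nᵀ) Vᵀ` is
skew-symmetric, so `A V + B Nᵀ = V G` with `G` skew-symmetric. The eigenvectors `u` of `G` have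
eigenvalues on the imaginary axis and yield pairs `x = V u`, `w = Nᵀ u` with `jω x = A x + B w`;
summing the frequency bound over them contradicts `Z ≠ 0` (`eq_zero_of_dual_feasible`). Finally
`w = 0` gives a Lyapunov inequality, so that `P ≻ 0` by Lyapunov's theorem
(`IsHurwitz.posDef_of_lyapunov`).
-/

open scoped ComplexOrder MatrixOrder

/-! ### Complex vectors, complexified matrices and the largest singular value -/

theorem Matrix.mem_spectrum_iff_exists_mulVec {ι : Type*} [Fintype ι] [DecidableEq ι]
    (M : Matrix ι ι ℂ) (z : ℂ) : z ∈ spectrum ℂ M ↔ ∃ v ≠ 0, M *ᵥ v = z • v := by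
  rw [spectrum.mem_iff, Matrix.isUnit_iff_isUnit_det, isUnit_iff_ne_zero, not_not,
    ← Matrix.exists_mulVec_eq_zero_iff]
  simp only [sub_mulVec, algebraMap_eq_diagonal, Pi.algebraMap_def, Algebra.algebraMap_self,
    RingHom.id_apply, sub_eq_zero]
  have (v : ι → ℂ) : (diagonal fun _ : ι => z) *ᵥ v = z • v := by
    ext i; simp [mulVec_diagonal]
  simp only [this, eq_comm]

/-- The squared Euclidean norm of a complex vector. -/
noncomputable def sqNorm {ι : Type*} [Fintype ι] (v : ι → ℂ) : ℝ := ∑ i, ‖v i‖ ^ 2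

section sqNorm
variable {ι : Type*} [Fintype ι]

theorem star_dotProduct_self_eq_sqNorm (v : ι → ℂ) : star v ⬝ᵥ v = (sqNorm v : ℂ) := by
  simp [sqNorm, dotProduct, Complex.conj_mul']

theorem sqNorm_nonneg (v : ι → ℂ) : 0 ≤ sqNorm v := Finset.sum_nonneg fun _ _ => sq_nonneg _

theorem sqNorm_eq_zero {v : ι → ℂ} : sqNorm v = 0 ↔ v = 0 := by
  rw [sqNorm, Finset.sum_eq_zero_iff_of_nonneg fun _ _ => sq_nonneg _]
  simp [funext_iff]

theorem sqNorm_pos {v : ι → ℂ} (hv : v ≠ 0) : 0 < sqNorm v :=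
  (sqNorm_nonneg v).lt_of_ne fun h => hv (sqNorm_eq_zero.1 h.symm)

theorem norm_sq_eq_sqNorm (v : EuclideanSpace ℂ ι) : ‖v‖ ^ 2 = sqNorm v.ofLp :=
  EuclideanSpace.norm_sq_eq v

/-- Completing the square: `2 Re ⟨y, w⟩ - μ |y|² ≤ |w|² / μ`. -/
theorem two_mul_re_dotProduct_sub_le (y w : ι → ℂ) {μ : ℝ} (hμ : 0 < μ) :
    2 * (star y ⬝ᵥ w).re - μ * sqNorm y ≤ μ⁻¹ * sqNorm w := by
  simp only [sqNorm, dotProduct, Complex.re_sum, Finset.mul_sum, ← Finset.sum_sub_distrib]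
  refine Finset.sum_le_sum fun i _ => ?_
  have h : (star y i * w i).re ≤ ‖y i‖ * ‖w i‖ := by
    refine (Complex.re_le_norm _).trans ?_
    simp
  have h2 : 0 ≤ μ⁻¹ * (‖w i‖ - μ * ‖y i‖) ^ 2 := by positivity
  have h3 : μ⁻¹ * (‖w i‖ - μ * ‖y i‖) ^ 2
      = μ⁻¹ * ‖w i‖ ^ 2 - 2 * (‖y i‖ * ‖w i‖) + μ * ‖y i‖ ^ 2 := by
    field_simp
    ring
  linarith

end sqNorm

theorem sqNorm_mulVec_le {q l : ℕ} (M : Matrix (Fin q) (Fin l) ℂ) (v : Fin l → ℂ) :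
    sqNorm (M *ᵥ v) ≤ maxSingularValue M ^ 2 * sqNorm v := by
  have h := (LinearMap.toContinuousLinearMap (Matrix.toEuclideanLin M)).le_opNorm
    (WithLp.toLp 2 v)
  have h2 := pow_le_pow_left₀ (norm_nonneg _) h 2
  rw [mul_pow, norm_sq_eq_sqNorm, norm_sq_eq_sqNorm] at h2
  simpa [maxSingularValue] using h2

theorem maxSingularValue_le {q l : ℕ} (M : Matrix (Fin q) (Fin l) ℂ) {c : ℝ} (hc : 0 ≤ c)
    (h : ∀ v, sqNorm (M *ᵥ v) ≤ c ^ 2 * sqNorm v) : maxSingularValue M ≤ c := by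
  refine ContinuousLinearMap.opNorm_le_bound _ hc fun v => ?_
  refine le_of_sq_le_sq ?_ (by positivity)
  rw [mul_pow, norm_sq_eq_sqNorm, norm_sq_eq_sqNorm]
  simpa using h v.ofLp

section complexify
variable {ι κ : Type*}

theorem Matrix.conjTranspose_map_ofReal (M : Matrix ι κ ℝ) :
    (M.map Complex.ofReal)ᴴ = Mᵀ.map Complex.ofReal := by
  ext; simp

theorem Matrix.map_ofReal_mul {ν : Type*} [Fintype ι] (M : Matrix ν ι ℝ) (N : Matrix ι κ ℝ) :
    (M * N).map Complex.ofReal = M.map Complex.ofReal * N.map Complex.ofReal :=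
  Matrix.map_mul (f := Complex.ofRealHom)

theorem Matrix.PosSemidef.map_ofReal [Fintype ι] {M : Matrix ι ι ℝ} (h : M.PosSemidef) :
    (M.map Complex.ofReal).PosSemidef := by
  classical
  obtain ⟨E, rfl⟩ := CStarAlgebra.nonneg_iff_eq_star_mul_self.mp h.nonneg
  rw [star_eq_conjTranspose, Matrix.map_ofReal_mul, conjTranspose_eq_transpose_of_trivial,
    ← conjTranspose_map_ofReal]
  exact posSemidef_conjTranspose_mul_self _

theorem Matrix.PosDef.map_ofReal [Fintype ι] {M : Matrix ι ι ℝ} (h : M.PosDef) :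
    (M.map Complex.ofReal).PosDef := by
  classical
  refine (h.posSemidef.map_ofReal.posDef_iff_isUnit).2 ?_
  exact h.isUnit.map (Complex.ofRealHom.mapMatrix (m := ι))

end complexify

/-- The Riccati inequality as a dissipation inequality: along `A x` the derivative of the storage
function `x ↦ ⟨x, P x⟩` plus the supply `|C x|² + μ |Bᴴ P x|²` is nonpositive. -/
theorem dissipation_of_riccati {ι κ ν : Type*} [Fintype ι] [Fintype κ] [Fintype ν]
    {P A : Matrix ι ι ℂ} {B : Matrix ι κ ℂ} {C : Matrix ν ι ℂ} {μ : ℝ} (hP : P.IsHermitian)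
    (h : (-(P * A + Aᴴ * P + Cᴴ * C + (μ : ℂ) • (P * B * Bᴴ * P))).PosSemidef) (x : ι → ℂ) :
    2 * (star (P *ᵥ x) ⬝ᵥ (A *ᵥ x)).re + sqNorm (C *ᵥ x) + μ * sqNorm (Bᴴ *ᵥ (P *ᵥ x)) ≤ 0 := by
  have h0 := (Complex.le_def.1 (h.dotProduct_mulVec_nonneg x)).1
  have e1 : star x ⬝ᵥ (P * A) *ᵥ x = star (P *ᵥ x) ⬝ᵥ (A *ᵥ x) := by
    rw [star_mulVec, hP.eq, ← dotProduct_mulVec, mulVec_mulVec]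
  have e2 : star x ⬝ᵥ (Aᴴ * P) *ᵥ x = star (star (P *ᵥ x) ⬝ᵥ (A *ᵥ x)) := by
    rw [← mulVec_mulVec, dotProduct_mulVec, ← star_mulVec, star_dotProduct (A *ᵥ x)]
  have e3 : star x ⬝ᵥ (Cᴴ * C) *ᵥ x = (sqNorm (C *ᵥ x) : ℂ) := by
    rw [← star_dotProduct_self_eq_sqNorm, star_mulVec, ← dotProduct_mulVec, mulVec_mulVec]
  have e4 : star x ⬝ᵥ (P * B * Bᴴ * P) *ᵥ x = (sqNorm (Bᴴ *ᵥ (P *ᵥ x)) : ℂ) := by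
    rw [← star_dotProduct_self_eq_sqNorm, star_mulVec, star_mulVec, ← dotProduct_mulVec,
      ← dotProduct_mulVec, mulVec_mulVec, mulVec_mulVec, mulVec_mulVec, hP.eq,
      conjTranspose_conjTranspose]
  rw [neg_mulVec, add_mulVec, add_mulVec, add_mulVec, smul_mulVec, dotProduct_neg,
    dotProduct_add, dotProduct_add, dotProduct_add, dotProduct_smul, e1, e2, e3, e4] at h0
  simp [-mulVec_mulVec] at h0
  linarith

/-! ### Convexity and the closed-loop form of `Θ₁` -/

namespace LTISystem
variable {n m l q : ℕ}

theorem theta_smul_add_smul (S : LTISystem n m l q)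
    (X Y : Matrix (Fin n ⊕ Fin m) (Fin n ⊕ Fin m) ℝ) (μ ν : ℝ) {a b : ℝ} (hab : a + b = 1) :
    S.theta (a • X + b • Y) (a • μ + b • ν) =
      a • S.theta X μ + b • S.theta Y ν - (a * b) • ((X - Y) * S.extR * (X - Y)) := by
  obtain rfl : b = 1 - a := by linarith
  simp only [theta, add_mul, mul_add, sub_mul, mul_sub, Matrix.smul_mul, Matrix.mul_smul,
    smul_eq_mul]
  module

theorem extR_eq (S : LTISystem n m l q) :
    S.extR = (fromBlocks S.C 0 0 S.D)ᵀ * fromBlocks S.C 0 0 S.D := by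
  simp [extR, fromBlocks_transpose, fromBlocks_multiply]

/-- `Θ` is convex for the Loewner order because `W ↦ W R W` is, `R` being positive semidefinite. -/
theorem convex_paramSet (S : LTISystem n m l q) : Convex ℝ S.paramSet := by
  rintro ⟨X, μ⟩ ⟨hX, hX1, hXθ, hμ⟩ ⟨Y, ν⟩ ⟨hY, hY1, hYθ, hν⟩ a b ha hb hab
  refine ⟨(hX.smul ha).add (hY.smul hb), ?_, ?_, ?_⟩
  · change (a • X.toBlocks₁₁ + b • Y.toBlocks₁₁).PosDef
    rcases ha.eq_or_lt with rfl | ha'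
    · obtain rfl : b = 1 := by linarith
      simpa using hY1
    · exact (hX1.smul ha').add_posSemidef (hY1.posSemidef.smul hb)
  · have hΔ : ((X - Y) * S.extR * (X - Y)).PosSemidef := by
      have h := posSemidef_conjTranspose_mul_self (fromBlocks S.C 0 0 S.D * (X - Y))
      rwa [conjTranspose_mul, (hX.isHermitian.sub hY.isHermitian).eq,
        conjTranspose_eq_transpose_of_trivial, Matrix.mul_assoc, ← Matrix.mul_assoc _ᵀ,
        ← extR_eq, ← Matrix.mul_assoc] at h
    have h := ((hXθ.smul ha).add (hYθ.smul hb)).add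
      ((hΔ.submatrix Sum.inl).smul (mul_nonneg ha hb))
    convert h using 1
    change -(S.theta (a • X + b • Y) (a • μ + b • ν)).submatrix Sum.inl Sum.inl = _
    rw [theta_smul_add_smul S X Y μ ν hab]
    ext i j
    simp [theta₁, toBlocks₁₁]
    ring
  · change 0 < a * μ + b * ν
    rcases ha.eq_or_lt with rfl | ha'
    · obtain rfl : b = 1 := by linarith
      simpa using hν
    · exact add_pos_of_pos_of_nonneg (mul_pos ha' hμ) (mul_nonneg hb hν.le)

/-- For the feedback `K` encoded by `W₂ = W₁ Kᵀ`, the block `Θ₁` is the Riccati expression of the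
closed loop; the cross terms of `(C - D K)ᵀ (C - D K)` vanish because `Cᵀ D = 0`. -/
theorem theta₁_fromBlocks (S : LTISystem n m l q) (hCD : S.Cᵀ * S.D = 0)
    (W₁ : Matrix (Fin n) (Fin n) ℝ) (K : Matrix (Fin m) (Fin n) ℝ)
    (W₃ : Matrix (Fin m) (Fin m) ℝ) (μ : ℝ) :
    S.theta₁ (fromBlocks W₁ (W₁ * Kᵀ) (K * W₁) W₃) μ =
      S.closedLoopA K * W₁ + W₁ * (S.closedLoopA K)ᵀ +
        W₁ * ((S.closedLoopC K)ᵀ * S.closedLoopC K) * W₁ + μ • (S.B₁ * S.B₁ᵀ) := by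
  have hDC : S.Dᵀ * S.C = 0 := by
    rw [← transpose_transpose (S.Dᵀ * S.C), transpose_mul, transpose_transpose, hCD,
      transpose_zero]
  have hCC : (S.closedLoopC K)ᵀ * S.closedLoopC K = S.Cᵀ * S.C + Kᵀ * (S.Dᵀ * S.D) * K := by
    have e1 : S.Cᵀ * (S.D * K) = 0 := by rw [← Matrix.mul_assoc, hCD, Matrix.zero_mul]
    have e2 : Kᵀ * S.Dᵀ * S.C = 0 := by rw [Matrix.mul_assoc, hDC, Matrix.mul_zero]
    simp only [closedLoopC, transpose_sub, transpose_mul, Matrix.sub_mul, Matrix.mul_sub, e1, e2,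
      Matrix.mul_assoc]
    simp
  rw [hCC]
  simp only [theta₁, theta, extF, extR, extQ, fromBlocks_transpose, fromBlocks_multiply,
    fromBlocks_add, fromBlocks_smul, toBlocks_fromBlocks₁₁, closedLoopA]
  simp only [transpose_sub, transpose_mul, transpose_neg, Matrix.sub_mul, Matrix.mul_sub,
    Matrix.add_mul, Matrix.mul_add, Matrix.mul_zero, add_zero, zero_add, Matrix.mul_assoc, Matrix.neg_mul,
    Matrix.mul_neg]
  abel

/-- The off-diagonal blocks of `W` in terms of the gain `K` it generates: `W₂ = W₁ Kᵀ`. -/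
theorem eq_fromBlocks_gainOf {W : Matrix (Fin n ⊕ Fin m) (Fin n ⊕ Fin m) ℝ}
    (hW : W.IsHermitian) (hW1 : W.toBlocks₁₁.PosDef) :
    W = fromBlocks W.toBlocks₁₁ (W.toBlocks₁₁ * (gainOf W)ᵀ) (gainOf W * W.toBlocks₁₁)
      W.toBlocks₂₂ := by
  have hu := (Matrix.isUnit_iff_isUnit_det _).1 hW1.isUnit
  have ht : W.toBlocks₁₁ᵀ = W.toBlocks₁₁ := hW1.isHermitian
  have hg : gainOf W * W.toBlocks₁₁ = W.toBlocks₁₂ᵀ := by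
    rw [gainOf, Matrix.mul_assoc, nonsing_inv_mul _ hu, Matrix.mul_one]
  have hg' : W.toBlocks₁₁ * (gainOf W)ᵀ = W.toBlocks₁₂ := by
    rw [← transpose_transpose W.toBlocks₁₂, ← hg, transpose_mul, ht]
  have h21 : W.toBlocks₂₁ = W.toBlocks₁₂ᵀ := by
    ext i j
    exact (hW.apply (Sum.inr i) (Sum.inl j)).symm
  rw [hg, hg', ← h21, fromBlocks_toBlocks]

end LTISystem

/-! ### The Riccati inequality implies stability and the norm bound -/

theorem Matrix.map_ofReal_mulVec_eq_zero_iff {ι κ : Type*} [Fintype κ] (M : Matrix ι κ ℝ)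
    (x : κ → ℂ) : M.map Complex.ofReal *ᵥ x = 0 ↔
      M *ᵥ (fun i => (x i).re) = 0 ∧ M *ᵥ (fun i => (x i).im) = 0 := by
  simp only [funext_iff, ← forall_and, Complex.ext_iff]
  simp [mulVec, dotProduct]

/-- The eigenvector half of the Popov–Belevitch–Hautus test. -/
theorem IsObservablePair.eq_zero_of_mulVec_eq_smul {n q : ℕ} {A : Matrix (Fin n) (Fin n) ℝ}
    {C : Matrix (Fin q) (Fin n) ℝ} (h : IsObservablePair A C) {x : Fin n → ℂ} {z : ℂ}
    (hA : A.map Complex.ofReal *ᵥ x = z • x) (hC : C.map Complex.ofReal *ᵥ x = 0) : x = 0 := by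
  have hk (k : ℕ) : (C * A ^ k).map Complex.ofReal *ᵥ x = 0 := by
    have h2 : (A ^ k).map Complex.ofReal *ᵥ x = z ^ k • x := by
      induction k with
      | zero => simp
      | succ k ih =>
        rw [pow_succ, map_ofReal_mul, ← mulVec_mulVec, hA, mulVec_smul, ih, smul_smul, pow_succ']
    rw [map_ofReal_mul, ← mulVec_mulVec, h2, mulVec_smul, hC, smul_zero]
  simp only [map_ofReal_mulVec_eq_zero_iff] at hk
  have hre := h _ fun k _ => (hk k).1
  have him := h _ fun k _ => (hk k).2
  ext i
  exact Complex.ext (congrFun hre i) (congrFun him i)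

/-- The Riccati inequality `P A + Aᵀ P + Cᵀ C + μ P B Bᵀ P ⪯ 0`, the algebraic form of the bound
`1 / √μ` on the `H∞`-norm of `C (s - A)⁻¹ B`. -/
def RiccatiLE {ι κ ν : Type*} [Fintype ι] [Fintype κ] [Fintype ν] (P A : Matrix ι ι ℝ)
    (B : Matrix ι κ ℝ) (C : Matrix ν ι ℝ) (μ : ℝ) : Prop :=
  (-(P * A + Aᵀ * P + Cᵀ * C + μ • (P * B * Bᵀ * P))).PosSemidef

section riccati
variable {ι κ ν : Type*} [Fintype ι] [Fintype κ] [Fintype ν] {P A : Matrix ι ι ℝ}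
  {B : Matrix ι κ ℝ} {C : Matrix ν ι ℝ} {μ : ℝ}

theorem RiccatiLE.dissipation (h : RiccatiLE P A B C μ) (hP : P.PosDef) (x : ι → ℂ) :
    2 * (star (P.map Complex.ofReal *ᵥ x) ⬝ᵥ (A.map Complex.ofReal *ᵥ x)).re +
      sqNorm (C.map Complex.ofReal *ᵥ x) +
      μ * sqNorm ((B.map Complex.ofReal)ᴴ *ᵥ (P.map Complex.ofReal *ᵥ x)) ≤ 0 := by
  refine dissipation_of_riccati hP.map_ofReal.isHermitian ?_ x
  have h2 := PosSemidef.map_ofReal h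
  convert h2 using 1
  simp only [conjTranspose_map_ofReal, ← map_ofReal_mul]
  ext i j
  simp

/-- Pass between the Riccati inequality for `P` and its dual form for `P⁻¹`. -/
theorem riccatiLE_inv_iff [DecidableEq ι] {W : Matrix ι ι ℝ} (hW : W.PosDef) :
    RiccatiLE W⁻¹ A B C μ ↔
      (-(A * W + W * Aᵀ + W * (Cᵀ * C) * W + μ • (B * Bᵀ))).PosSemidef := by
  have hu := (Matrix.isUnit_iff_isUnit_det _).1 hW.isUnit
  have e : W * (-(W⁻¹ * A + Aᵀ * W⁻¹ + Cᵀ * C + μ • (W⁻¹ * B * Bᵀ * W⁻¹))) * star W =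
      -(A * W + W * Aᵀ + W * (Cᵀ * C) * W + μ • (B * Bᵀ)) := by
    have e1 (M : Matrix ι ι ℝ) : W * (W⁻¹ * M) = M := by
      rw [← Matrix.mul_assoc, mul_nonsing_inv _ hu, Matrix.one_mul]
    have e2 : W⁻¹ * W = 1 := nonsing_inv_mul _ hu
    rw [star_eq_conjTranspose, hW.isHermitian.eq]
    simp only [Matrix.mul_neg, Matrix.neg_mul, Matrix.mul_add, Matrix.add_mul, Matrix.mul_smul,
      Matrix.smul_mul, Matrix.mul_assoc, e1, e2, Matrix.mul_one]
  rw [RiccatiLE, ← e, hW.isUnit.posSemidef_star_right_conjugate_iff]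

end riccati

/-- A positive definite solution of the Riccati inequality is a Lyapunov function, and it is strict
along eigenvectors that the output sees. -/
theorem RiccatiLE.isHurwitz {n : ℕ} {κ ν : Type*} [Fintype κ] [Fintype ν]
    {P A : Matrix (Fin n) (Fin n) ℝ} {B : Matrix (Fin n) κ ℝ} {C : Matrix ν (Fin n) ℝ} {μ : ℝ}
    (h : RiccatiLE P A B C μ) (hP : P.PosDef) (hμ : 0 < μ)
    (hobs : ∀ (x : Fin n → ℂ) (z : ℂ), A.map Complex.ofReal *ᵥ x = z • x →
      C.map Complex.ofReal *ᵥ x = 0 → x = 0) : IsHurwitz A := by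
  intro z hz
  obtain ⟨x, hx, hAx⟩ := (mem_spectrum_iff_exists_mulVec _ _).1 hz
  have hd := h.dissipation hP x
  have hPC := hP.map_ofReal
  have hpos := Complex.lt_def.1 (hPC.dotProduct_mulVec_pos hx)
  have hC : 0 < sqNorm (C.map Complex.ofReal *ᵥ x) := sqNorm_pos fun h0 => hx (hobs x z hAx h0)
  have hB := sqNorm_nonneg ((B.map Complex.ofReal)ᴴ *ᵥ (P.map Complex.ofReal *ᵥ x))
  have e : star (P.map Complex.ofReal *ᵥ x) ⬝ᵥ (A.map Complex.ofReal *ᵥ x) =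
      z * (star x ⬝ᵥ P.map Complex.ofReal *ᵥ x) := by
    rw [hAx, dotProduct_smul, smul_eq_mul, star_mulVec, hPC.isHermitian.eq, ← dotProduct_mulVec]
  rw [e, Complex.mul_re, ← hpos.2] at hd
  by_contra! hre
  have := mul_nonneg hre hpos.1.le
  have := mul_nonneg hμ.le hB
  simp only [Complex.zero_re, Complex.zero_im, mul_zero, sub_zero] at *
  linarith

/-- On `jω x = A x + B w` the storage function is stationary, so the dissipation inequality bounds
the output by the input. -/
theorem RiccatiLE.sqNorm_le {ι κ ν : Type*} [Fintype ι] [Fintype κ] [Fintype ν]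
    {P A : Matrix ι ι ℝ} {B : Matrix ι κ ℝ} {C : Matrix ν ι ℝ} {μ : ℝ}
    (h : RiccatiLE P A B C μ) (hP : P.PosDef) (hμ : 0 < μ) {ω : ℝ} {x : ι → ℂ} {w : κ → ℂ}
    (hx : A.map Complex.ofReal *ᵥ x + B.map Complex.ofReal *ᵥ w = (Complex.I * ω) • x) :
    sqNorm (C.map Complex.ofReal *ᵥ x) ≤ μ⁻¹ * sqNorm w := by
  have hd := h.dissipation hP x
  have hPC := hP.map_ofReal
  have him := (Complex.le_def.1 (hPC.posSemidef.dotProduct_mulVec_nonneg x)).2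
  have hsq := two_mul_re_dotProduct_sub_le
    ((B.map Complex.ofReal)ᴴ *ᵥ (P.map Complex.ofReal *ᵥ x)) w hμ
  have e : star (P.map Complex.ofReal *ᵥ x) ⬝ᵥ (A.map Complex.ofReal *ᵥ x) =
      (Complex.I * ω) * (star x ⬝ᵥ P.map Complex.ofReal *ᵥ x) -
        star ((B.map Complex.ofReal)ᴴ *ᵥ (P.map Complex.ofReal *ᵥ x)) ⬝ᵥ w := by
    rw [eq_sub_of_add_eq hx, dotProduct_sub, dotProduct_smul, smul_eq_mul,
      star_mulVec _ (P.map Complex.ofReal *ᵥ x), conjTranspose_conjTranspose, ← dotProduct_mulVec,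
      star_mulVec, hPC.isHermitian.eq, ← dotProduct_mulVec]
  rw [e, Complex.sub_re, Complex.mul_re, ← him] at hd
  simp only [Complex.zero_im, mul_zero, sub_zero, Complex.mul_re, Complex.I_re, zero_mul,
    Complex.ofReal_im, Complex.I_im, zero_sub] at hd
  linarith

namespace LTISystem
variable {n m l q : ℕ}

theorem mulVec_eq_zero_of_closedLoopC_mulVec_eq_zero (S : LTISystem n m l q)
    (hCD : S.Cᵀ * S.D = 0) (hDD : (S.Dᵀ * S.D).PosDef) (K : Matrix (Fin m) (Fin n) ℝ)
    {a : Fin n → ℝ} (ha : S.closedLoopC K *ᵥ a = 0) : S.C *ᵥ a = 0 ∧ K *ᵥ a = 0 := by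
  have hC : S.C *ᵥ a = S.D *ᵥ (K *ᵥ a) := by
    rwa [closedLoopC, sub_mulVec, ← mulVec_mulVec, sub_eq_zero] at ha
  have hC0 : S.C *ᵥ a = 0 := by
    rw [← dotProduct_self_eq_zero]
    nth_rewrite 1 [hC]
    rw [dotProduct_mulVec, vecMul_mulVec, ← transpose_transpose (_ * _), transpose_mul,
      transpose_transpose, hCD]
    simp
  refine ⟨hC0, ?_⟩
  by_contra hK
  have := hDD.dotProduct_mulVec_pos hK
  rw [← mulVec_mulVec, ← hC, hC0] at this
  simp at this

/-- State feedback keeps observability of the pair because `Cᵀ D = 0` and `Dᵀ D ≻ 0`: a state that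
the closed-loop output misses is missed by `C` and produces no control. -/
theorem eq_zero_of_closedLoop_mulVec (S : LTISystem n m l q) (hobs : IsObservablePair S.A S.C)
    (hCD : S.Cᵀ * S.D = 0) (hDD : (S.Dᵀ * S.D).PosDef) (K : Matrix (Fin m) (Fin n) ℝ)
    (x : Fin n → ℂ) (z : ℂ) (hA : (S.closedLoopA K).map Complex.ofReal *ᵥ x = z • x)
    (hC : (S.closedLoopC K).map Complex.ofReal *ᵥ x = 0) : x = 0 := by
  rw [map_ofReal_mulVec_eq_zero_iff] at hC
  have hre := S.mulVec_eq_zero_of_closedLoopC_mulVec_eq_zero hCD hDD K hC.1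
  have him := S.mulVec_eq_zero_of_closedLoopC_mulVec_eq_zero hCD hDD K hC.2
  refine hobs.eq_zero_of_mulVec_eq_smul (z := z) ?_
    ((map_ofReal_mulVec_eq_zero_iff _ _).2 ⟨hre.1, him.1⟩)
  have hK := (map_ofReal_mulVec_eq_zero_iff K x).2 ⟨hre.2, him.2⟩
  rw [← hA, closedLoopA, ← sub_eq_zero, ← sub_mulVec]
  have : S.A.map Complex.ofReal - (S.A - S.B₂ * K).map Complex.ofReal =
      (S.B₂ * K).map Complex.ofReal := by ext; simp
  rw [this, map_ofReal_mul, ← mulVec_mulVec, hK, mulVec_zero]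

/-- The state `x = (jω - A_c)⁻¹ B₁ w` behind the transfer function solves `jω x = A_c x + B₁ w`. -/
theorem IsStabilizing.mulVec_add_mulVec {S : LTISystem n m l q} {K : Matrix (Fin m) (Fin n) ℝ}
    (hK : S.IsStabilizing K) (ω : ℝ) (x : Fin n → ℂ) (w : Fin l → ℂ) :
    (S.closedLoopA K).map Complex.ofReal *ᵥ x + S.B₁.map Complex.ofReal *ᵥ w =
        (Complex.I * ω) • x ↔
      x = ((Complex.I * ω) • (1 : Matrix (Fin n) (Fin n) ℂ) -
        (S.closedLoopA K).map Complex.ofReal)⁻¹ *ᵥ (S.B₁.map Complex.ofReal *ᵥ w) := by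
  have hu : IsUnit ((Complex.I * ω) • (1 : Matrix (Fin n) (Fin n) ℂ) -
      (S.closedLoopA K).map Complex.ofReal).det := by
    rw [← Matrix.isUnit_iff_isUnit_det]
    by_contra h
    have : (Complex.I * ω : ℂ) ∈ spectrum ℂ ((S.closedLoopA K).map Complex.ofReal) := by
      rwa [spectrum.mem_iff, Algebra.algebraMap_eq_smul_one]
    simpa using hK _ this
  rw [← eq_sub_iff_add_eq']
  have e : (Complex.I * ω) • x - (S.closedLoopA K).map Complex.ofReal *ᵥ x =
      ((Complex.I * ω) • (1 : Matrix (Fin n) (Fin n) ℂ) -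
        (S.closedLoopA K).map Complex.ofReal) *ᵥ x := by
    rw [sub_mulVec, smul_mulVec, one_mulVec]
  rw [e]
  constructor
  · intro h
    rw [h, mulVec_mulVec, nonsing_inv_mul _ hu, one_mulVec]
  · rintro rfl
    rw [mulVec_mulVec, mul_nonsing_inv _ hu, one_mulVec]

theorem transferFunction_mulVec (S : LTISystem n m l q) (K : Matrix (Fin m) (Fin n) ℝ) (s : ℂ)
    (w : Fin l → ℂ) : S.transferFunction K s *ᵥ w = (S.closedLoopC K).map Complex.ofReal *ᵥ
      ((s • (1 : Matrix (Fin n) (Fin n) ℂ) - (S.closedLoopA K).map Complex.ofReal)⁻¹ *ᵥ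
        (S.B₁.map Complex.ofReal *ᵥ w)) := by
  rw [transferFunction, mulVec_mulVec, mulVec_mulVec, Matrix.mul_assoc]

theorem isStabilizing_and_hInfNorm_le (S : LTISystem n m l q)
    (hobs : IsObservablePair S.A S.C) (hCD : S.Cᵀ * S.D = 0) (hDD : (S.Dᵀ * S.D).PosDef)
    {W : Matrix (Fin n ⊕ Fin m) (Fin n ⊕ Fin m) ℝ} {μ : ℝ} (h : (W, μ) ∈ S.paramSet) :
    S.IsStabilizing (gainOf W) ∧
      S.hInfNorm (gainOf W) ≤ ENNReal.ofReal (1 / Real.sqrt μ) := by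
  obtain ⟨hW, hW1, hΘ, hμ⟩ := h
  change W.PosSemidef at hW
  change W.toBlocks₁₁.PosDef at hW1
  change 0 < μ at hμ
  change (-(S.theta₁ W μ)).PosSemidef at hΘ
  rw [eq_fromBlocks_gainOf hW.isHermitian hW1, S.theta₁_fromBlocks hCD,
    ← riccatiLE_inv_iff hW1] at hΘ
  have hstab : S.IsStabilizing (gainOf W) :=
    hΘ.isHurwitz hW1.inv hμ (S.eq_zero_of_closedLoop_mulVec hobs hCD hDD _)
  refine ⟨hstab, iSup_le fun ω => ENNReal.ofReal_le_ofReal ?_⟩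
  refine maxSingularValue_le _ (by positivity) fun w => ?_
  rw [transferFunction_mulVec, div_pow, Real.sq_sqrt hμ.le, one_pow, one_div]
  exact hΘ.sqNorm_le hW1.inv hμ ((hstab.mulVec_add_mulVec ω _ w).2 rfl)

end LTISystem

/-! ### Lyapunov's theorem -/

section
open Filter Topology

attribute [local instance] Matrix.linftyOpNormedRing Matrix.linftyOpNormedAlgebra in
/-- The powers of a matrix whose eigenvalues lie in the open unit disc tend to zero, by Gelfand's
formula. -/
theorem Matrix.tendsto_pow_zero_of_spectrum_norm_lt_one {ι : Type*} [Fintype ι] [DecidableEq ι]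
    {M : Matrix ι ι ℂ} (h : ∀ z ∈ spectrum ℂ M, ‖z‖ < 1) :
    Tendsto (fun k : ℕ => M ^ k) atTop (𝓝 0) := by
  cases isEmpty_or_nonempty ι
  · simp only [Subsingleton.elim _ (0 : Matrix ι ι ℂ), tendsto_const_nhds]
  have : CompleteSpace (Matrix ι ι ℂ) := FiniteDimensional.complete ℂ _
  have hr : spectralRadius ℂ M < (1 : NNReal) :=
    spectrum.spectralRadius_lt_of_forall_lt M fun z hz => h z hz
  obtain ⟨r, hr0, hr1⟩ := ENNReal.lt_iff_exists_nnreal_btwn.1 hr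
  have hg := (spectrum.pow_nnnorm_pow_one_div_tendsto_nhds_spectralRadius M).eventually_lt_const hr0
  refine squeeze_zero_norm' (a := fun k => (r : ℝ) ^ k) ?_
    (tendsto_pow_atTop_nhds_zero_of_lt_one r.2 (by exact_mod_cast hr1))
  filter_upwards [hg, eventually_gt_atTop 0] with k hk hk0
  rw [one_div, ENNReal.rpow_inv_lt_iff (by positivity), ENNReal.rpow_natCast] at hk
  have : ‖M ^ k‖₊ < r ^ k := by exact_mod_cast hk
  exact_mod_cast this.le

theorem Matrix.tendsto_pow_zero_of_map_ofReal {ι : Type*} [Fintype ι] [DecidableEq ι]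
    {M : Matrix ι ι ℝ} (h : ∀ z ∈ spectrum ℂ (M.map Complex.ofReal), ‖z‖ < 1) :
    Tendsto (fun k : ℕ => M ^ k) atTop (𝓝 0) := by
  have h2 := tendsto_pow_zero_of_spectrum_norm_lt_one h
  have hc : Continuous fun N : Matrix ι ι ℂ => N.map Complex.re :=
    continuous_id.matrix_map Complex.continuous_re
  have h3 := (hc.tendsto 0).comp h2
  have e (k : ℕ) : M.map Complex.ofReal ^ k = (M ^ k).map Complex.ofReal :=
    (map_pow (Complex.ofRealHom.mapMatrix (m := ι)) M k).symm
  simpa [Function.comp_def, e, Matrix.map_map] using h3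

end

theorem IsHurwitz.isUnit_one_sub {n : ℕ} {A : Matrix (Fin n) (Fin n) ℝ} (hA : IsHurwitz A) :
    IsUnit (1 - A) := by
  rw [Matrix.isUnit_iff_isUnit_det, isUnit_iff_ne_zero]
  intro h0
  obtain ⟨v, hv, hv0⟩ := Matrix.exists_mulVec_eq_zero_iff.2 h0
  have hAv : A *ᵥ v = v := by
    rw [sub_mulVec, one_mulVec, sub_eq_zero] at hv0
    exact hv0.symm
  have : (1 : ℂ) ∈ spectrum ℂ (A.map Complex.ofReal) := by
    rw [mem_spectrum_iff_exists_mulVec]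
    refine ⟨fun i => v i, fun h => hv ?_, ?_⟩
    · ext i
      simpa using congrFun h i
    · ext i
      have := congrFun hAv i
      simp only [mulVec, dotProduct, one_smul, map_apply] at this ⊢
      exact_mod_cast this
  have := hA _ this
  norm_num at this

/-- The Cayley transform `(1 + A) (1 - A)⁻¹` sends the open left half plane to the unit disc. -/
theorem IsHurwitz.norm_lt_one_of_mem_spectrum_cayley {n : ℕ} {A : Matrix (Fin n) (Fin n) ℝ}
    (hA : IsHurwitz A) {z : ℂ}
    (hz : z ∈ spectrum ℂ (((1 + A) * (1 - A)⁻¹).map Complex.ofReal)) : ‖z‖ < 1 := by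
  obtain ⟨v, hv, hzv⟩ := (mem_spectrum_iff_exists_mulVec _ _).1 hz
  have hu := (Matrix.isUnit_iff_isUnit_det _).1 hA.isUnit_one_sub
  set y := (1 - A)⁻¹.map Complex.ofReal *ᵥ v with hy
  have hm (s : Matrix (Fin n) (Fin n) ℝ) : s.map Complex.ofReal = Complex.ofRealHom.mapMatrix s :=
    rfl
  have hvy : v = y - A.map Complex.ofReal *ᵥ y := by
    have : (1 - A).map Complex.ofReal *ᵥ y = v := by
      rw [hy, mulVec_mulVec, ← map_ofReal_mul, mul_nonsing_inv _ hu, hm, map_one, one_mulVec]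
    rw [← this, hm, map_sub, map_one, sub_mulVec, one_mulVec, ← hm]
  have hy0 : y ≠ 0 := by
    intro h0
    rw [h0] at hvy
    simp at hvy
    exact hv hvy
  have key : y + A.map Complex.ofReal *ᵥ y = z • (y - A.map Complex.ofReal *ᵥ y) := by
    rw [← hvy, ← hzv, map_ofReal_mul, ← mulVec_mulVec, ← hy, hm, hm, map_add, map_one, add_mulVec,
      one_mulVec]
  have key2 : (1 + z) • (A.map Complex.ofReal *ᵥ y) = (z - 1) • y := by
    rw [smul_sub] at key
    rw [add_smul, sub_smul, one_smul, one_smul, ← sub_eq_zero]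
    rw [← sub_eq_zero] at key
    rw [← key]
    abel
  have hz1 : 1 + z ≠ 0 := by
    intro h0
    rw [h0, zero_smul, eq_comm, smul_eq_zero] at key2
    rcases key2 with h1 | h1
    · have : (2 : ℂ) = 0 := by linear_combination h0 - h1
      norm_num at this
    · exact hy0 h1
  have hmem : (z - 1) / (1 + z) ∈ spectrum ℂ (A.map Complex.ofReal) := by
    refine (mem_spectrum_iff_exists_mulVec _ _).2 ⟨y, hy0, ?_⟩
    rw [div_eq_inv_mul, mul_smul, ← key2, smul_smul, inv_mul_cancel₀ hz1, one_smul]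
  have hre := hA _ hmem
  rw [Complex.div_re, ← add_div, div_neg_iff] at hre
  have hpos := Complex.normSq_pos.2 hz1
  have hneg := (hre.resolve_left fun h => absurd hpos (not_lt.2 h.2.le)).1
  have hn : ‖z‖ ^ 2 < 1 := by
    rw [Complex.sq_norm, Complex.normSq_apply]
    simp at hneg
    nlinarith
  exact (sq_lt_one_iff₀ (norm_nonneg z)).1 hn

/-- Lyapunov's theorem. The Cayley transform `M` of `A` satisfies `V (M x) < V x` for the form
`V x = ⟨x, P x⟩`, and `V (M ^ k x) → 0`, so that `V` is positive. -/
theorem IsHurwitz.posDef_of_lyapunov {n : ℕ} {A P : Matrix (Fin n) (Fin n) ℝ} (hA : IsHurwitz A)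
    (hP : Pᵀ = P) (h : ∀ x ≠ 0, x ⬝ᵥ P *ᵥ (A *ᵥ x) < 0) : P.PosDef := by
  have hu := (Matrix.isUnit_iff_isUnit_det _).1 hA.isUnit_one_sub
  set M := (1 + A) * (1 - A)⁻¹ with hM
  let V : (Fin n → ℝ) → ℝ := fun x => x ⬝ᵥ P *ᵥ x
  have hsymm (x y : Fin n → ℝ) : x ⬝ᵥ P *ᵥ y = y ⬝ᵥ P *ᵥ x := by
    rw [dotProduct_mulVec, ← mulVec_transpose, hP, dotProduct_comm]
  have hdec (x : Fin n → ℝ) (hx : x ≠ 0) : V (M *ᵥ x) < V x := by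
    set y := (1 - A)⁻¹ *ᵥ x with hy
    have hxy : x = y - A *ᵥ y := by
      have : (1 - A) *ᵥ y = x := by rw [hy, mulVec_mulVec, mul_nonsing_inv _ hu, one_mulVec]
      rw [← this, sub_mulVec, one_mulVec]
    have hMx : M *ᵥ x = y + A *ᵥ y := by
      rw [hM, ← mulVec_mulVec, ← hy, add_mulVec, one_mulVec]
    have hy0 : y ≠ 0 := by
      rintro h0
      rw [h0] at hxy
      simp at hxy
      exact hx hxy
    have hlt := h y hy0
    have e1 := hsymm (A *ᵥ y) y
    change (M *ᵥ x) ⬝ᵥ P *ᵥ (M *ᵥ x) < x ⬝ᵥ P *ᵥ x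
    rw [hMx, hxy]
    simp only [add_dotProduct, sub_dotProduct, mulVec_add, mulVec_sub, dotProduct_add,
      dotProduct_sub, e1]
    linarith
  have hle (x : Fin n → ℝ) : V (M *ᵥ x) ≤ V x := by
    rcases eq_or_ne x 0 with rfl | hx
    · simp
    · exact (hdec x hx).le
  have hlim (x : Fin n → ℝ) : Filter.Tendsto (fun k : ℕ => V (M ^ k *ᵥ x)) Filter.atTop
      (nhds 0) := by
    have hc : Continuous fun N : Matrix (Fin n) (Fin n) ℝ => V (N *ᵥ x) := by
      unfold V; fun_prop
    have := (hc.tendsto 0).comp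
      (tendsto_pow_zero_of_map_ofReal fun z hz => hA.norm_lt_one_of_mem_spectrum_cayley hz)
    simpa [V, Function.comp_def, ← hM] using this
  have hnonneg (x : Fin n → ℝ) : 0 ≤ V x := by
    have hanti : Antitone fun k : ℕ => V (M ^ k *ᵥ x) := by
      refine antitone_nat_of_succ_le fun k => ?_
      rw [pow_succ', ← mulVec_mulVec]
      exact hle _
    simpa using hanti.le_of_tendsto (hlim x) 0
  refine PosDef.of_dotProduct_mulVec_pos hP fun x hx => ?_
  exact (hnonneg _).trans_lt (hdec x hx)

/-! ### The dual of the bounded real lemma -/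

section duality
variable {ι κ ν : Type*} [Fintype ι] [Fintype κ] [Fintype ν] [DecidableEq ι]

/-- A positive semidefinite block matrix agrees with some `[V; Nᵀ] [V; Nᵀ]ᵀ` in the first block row,
and its lower right block has at least the trace of `Nᵀ N`. Here `V = Q diag d` with `Q` orthogonal;
entries of `d` may vanish, and then so do the corresponding rows of `N`. -/
theorem Matrix.PosSemidef.exists_block_factor {Z : Matrix (ι ⊕ κ) (ι ⊕ κ) ℝ} (hZ : Z.PosSemidef) :
    ∃ (Q : Matrix ι ι ℝ) (d : ι → ℝ) (N : Matrix ι κ ℝ), Qᵀ * Q = 1 ∧ Q * Qᵀ = 1 ∧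
      Z.toBlocks₁₁ = Q * diagonal d * (Q * diagonal d)ᵀ ∧ Z.toBlocks₁₂ = Q * diagonal d * N ∧
      (∀ i, d i = 0 → ∀ k, N i k = 0) ∧ (Nᵀ * N).trace ≤ Z.toBlocks₂₂.trace := by
  have hZ₁ : Z.toBlocks₁₁.PosSemidef := hZ.submatrix Sum.inl
  have h21 : Z.toBlocks₂₁ = Z.toBlocks₁₂ᵀ := by
    ext i j
    exact (hZ.isHermitian.apply (Sum.inr i) (Sum.inl j)).symm
  set e := hZ₁.isHermitian.eigenvalues with he
  have he0 (i : ι) : 0 ≤ e i := hZ₁.eigenvalues_nonneg i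
  obtain ⟨Q, hQ⟩ : ∃ Q : Matrix ι ι ℝ, Q = hZ₁.isHermitian.eigenvectorUnitary := ⟨_, rfl⟩
  have hQ1 : Qᵀ * Q = 1 := by
    rw [hQ]
    exact Unitary.coe_star_mul_self hZ₁.isHermitian.eigenvectorUnitary
  have hQ2 : Q * Qᵀ = 1 := by
    rw [hQ]
    exact Unitary.coe_mul_star_self hZ₁.isHermitian.eigenvectorUnitary
  have hspec : Z.toBlocks₁₁ = Q * diagonal e * Qᵀ := by
    rw [hQ]
    exact hZ₁.isHermitian.spectral_theorem
  set d : ι → ℝ := fun i => Real.sqrt (e i) with hd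
  have hdd : diagonal d * diagonal d = diagonal e := by
    rw [diagonal_mul_diagonal]
    congr 1
    ext i
    exact Real.mul_self_sqrt (he0 i)
  have hzero (i : ι) (hi : d i = 0) (k : κ) : (Qᵀ * Z.toBlocks₁₂) i k = 0 := by
    have hei : e i = 0 := (Real.sqrt_eq_zero (he0 i)).1 hi
    have h11 : Z.toBlocks₁₁ *ᵥ Q.col i = 0 := by
      have : Z.toBlocks₁₁ * Q = Q * diagonal e := by
        rw [hspec, Matrix.mul_assoc, hQ1, Matrix.mul_one]
      ext j
      have := congrFun (congrFun this j) i
      rw [mul_diagonal, hei, mul_zero] at this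
      exact this
    have hx : Z *ᵥ Sum.elim (Q.col i) 0 = 0 := by
      rw [← hZ.dotProduct_mulVec_zero_iff, ← fromBlocks_toBlocks Z, fromBlocks_mulVec]
      simp [h11, dotProduct, Fintype.sum_sum_type]
    have := congrFun hx (Sum.inr k)
    rw [← fromBlocks_toBlocks Z, fromBlocks_mulVec, h21] at this
    simpa [mulVec, dotProduct, mul_apply, mul_comm] using this
  -- Rows with `d i = 0` get the junk value `x / 0 = 0`, which is the value they need.
  set N : Matrix ι κ ℝ := of fun i k => (Qᵀ * Z.toBlocks₁₂) i k / d i with hN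
  have hDN : diagonal d * N = Qᵀ * Z.toBlocks₁₂ := by
    ext i k
    rw [diagonal_mul, hN, of_apply]
    by_cases hi : d i = 0
    · rw [hi, zero_mul, hzero i hi]
    · rw [mul_div_cancel₀ _ hi]
  have h12 : Z.toBlocks₁₂ = Q * diagonal d * N := by
    rw [Matrix.mul_assoc, hDN, ← Matrix.mul_assoc, hQ2, Matrix.one_mul]
  have hN0 (i : ι) (hi : d i = 0) (k : κ) : N i k = 0 := by simp [hN, hi]
  have h11 : Z.toBlocks₁₁ = Q * diagonal d * (Q * diagonal d)ᵀ := by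
    rw [hspec, transpose_mul, diagonal_transpose, Matrix.mul_assoc Q (diagonal d),
      ← Matrix.mul_assoc (diagonal d), hdd, Matrix.mul_assoc]
  refine ⟨Q, d, N, hQ1, hQ2, h11, h12, hN0, ?_⟩
  classical
  -- The first block row of `Z` annihilates `[T; 1]`, so congruence by `[T; 1]` leaves the
  -- generalized Schur complement `Z₂₂ - Nᵀ N`.
  set T : Matrix ι κ ℝ := -(Q * (diagonal (fun i => (d i)⁻¹) * N)) with hT
  have hVT : (Q * diagonal d)ᵀ * T = -N := by
    have : diagonal d * (diagonal (fun i => (d i)⁻¹) * N) = N := by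
      ext i k
      rw [diagonal_mul, diagonal_mul]
      by_cases hi : d i = 0
      · rw [hi, zero_mul, hN0 i hi]
      · field_simp
    rw [hT, Matrix.mul_neg, transpose_mul, diagonal_transpose, Matrix.mul_assoc,
      ← Matrix.mul_assoc Qᵀ, hQ1, Matrix.one_mul, this]
  have hps := hZ.conjTranspose_mul_mul_same (fromRows T (1 : Matrix κ κ ℝ))
  have hcalc : (fromRows T (1 : Matrix κ κ ℝ))ᴴ * Z * fromRows T (1 : Matrix κ κ ℝ) =
      Z.toBlocks₂₂ - Nᵀ * N := by
    rw [Matrix.mul_assoc]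
    nth_rewrite 1 [← fromBlocks_toBlocks Z]
    rw [conjTranspose_eq_transpose_of_trivial, transpose_fromRows, fromBlocks_mul_fromRows,
      fromCols_mul_fromRows, h21, h11, h12]
    have e1 : Q * diagonal d * (Q * diagonal d)ᵀ * T = -(Q * diagonal d * N) := by
      rw [Matrix.mul_assoc, hVT, Matrix.mul_neg]
    have e2 : (Q * diagonal d * N)ᵀ * T = -(Nᵀ * N) := by
      rw [transpose_mul, Matrix.mul_assoc, hVT, Matrix.mul_neg]
    rw [e1, e2]
    simp [sub_eq_neg_add]
  rw [hcalc] at hps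
  have := hps.trace_nonneg
  rw [trace_sub] at this
  linarith

/-- If `Y Vᵀ` is skew-symmetric for `V = Q diag d` with `Q` orthogonal, then `Y = V G` with `G`
skew-symmetric. Since `V` may be singular, the columns of `Y` have to vanish where `d` does. -/
theorem Matrix.exists_skew_factor {Q Y : Matrix ι ι ℝ} {d : ι → ℝ} (hQ1 : Qᵀ * Q = 1)
    (hQ2 : Q * Qᵀ = 1) (hY : Y * (Q * diagonal d)ᵀ + Q * diagonal d * Yᵀ = 0)
    (hzero : ∀ j, d j = 0 → ∀ i, Y i j = 0) :
    ∃ G : Matrix ι ι ℝ, Gᵀ = -G ∧ Y = Q * diagonal d * G := by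
  have hY' : (Qᵀ * Y) * diagonal d + diagonal d * (Qᵀ * Y)ᵀ = 0 := by
    have : Qᵀ * (Y * (Q * diagonal d)ᵀ + Q * diagonal d * Yᵀ) * Q = 0 := by
      rw [hY, Matrix.mul_zero, Matrix.zero_mul]
    rw [← this, Matrix.mul_add, Matrix.add_mul, transpose_mul, transpose_mul, diagonal_transpose,
      transpose_transpose]
    simp only [Matrix.mul_assoc, hQ1, Matrix.mul_one]
    rw [← Matrix.mul_assoc Qᵀ Q, hQ1, Matrix.one_mul]
  have hent (i j : ι) : (Qᵀ * Y) i j * d j + d i * (Qᵀ * Y) j i = 0 := by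
    have := congrFun (congrFun hY' i) j
    simpa only [add_apply, mul_diagonal, diagonal_mul, transpose_apply, zero_apply] using this
  have hcol (i j : ι) (hj : d j = 0) : (Qᵀ * Y) i j = 0 := by
    simp [mul_apply, hzero j hj]
  have hrow (i j : ι) (hi : d i = 0) : (Qᵀ * Y) i j = 0 := by
    by_cases hj : d j = 0
    · exact hcol i j hj
    · have := hent i j
      rw [hi, zero_mul, add_zero] at this
      exact (mul_eq_zero.1 this).resolve_right hj
  -- Where `d i = 0` the junk value `x / 0 = 0` is the right one.
  refine ⟨of fun i j => (Qᵀ * Y) i j / d i, ?_, ?_⟩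
  · ext i j
    simp only [transpose_apply, neg_apply, of_apply]
    by_cases hi : d i = 0
    · rw [hi, div_zero, neg_zero, hcol j i hi, zero_div]
    by_cases hj : d j = 0
    · rw [hj, div_zero, hcol i j hj, zero_div, neg_zero]
    · rw [div_eq_iff hj, neg_mul, div_mul_eq_mul_div, ← neg_div, eq_div_iff hi]
      linarith [hent i j]
  · have : diagonal d * of (fun i j => (Qᵀ * Y) i j / d i) = Qᵀ * Y := by
      ext i j
      rw [diagonal_mul, of_apply]
      by_cases hi : d i = 0
      · rw [hi, zero_mul, hrow i j hi]
      · rw [mul_div_cancel₀ _ hi]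
    rw [Matrix.mul_assoc, this, ← Matrix.mul_assoc, hQ2, Matrix.one_mul]

/-- The trace of `M Mᵀ` as a sum over the columns of a unitary matrix. -/
theorem Matrix.sum_sqNorm_mulVec_col {U : Matrix ι ι ℂ} (hU : U * Uᴴ = 1) (M : Matrix ν ι ℝ) :
    ∑ j, sqNorm (M.map Complex.ofReal *ᵥ U.col j) = (M * Mᵀ).trace := by
  have h : ((M.map Complex.ofReal * U) * (M.map Complex.ofReal * U)ᴴ) =
      (M * Mᵀ).map Complex.ofReal := by
    rw [conjTranspose_mul, Matrix.mul_assoc, ← Matrix.mul_assoc U, hU, Matrix.one_mul,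
      conjTranspose_map_ofReal, map_ofReal_mul]
  simp only [sqNorm, trace]
  rw [Finset.sum_comm]
  refine Finset.sum_congr rfl fun k _ => ?_
  have h2 := congrFun (congrFun h k) k
  rw [mul_apply] at h2
  simp only [conjTranspose_apply, map_apply, Complex.star_def, Complex.mul_conj'] at h2
  rw [diag_apply]
  exact_mod_cast h2

/-- The dual of the strict bounded real lemma: under the strict frequency condition no nonzero
`Z ⪰ 0` satisfies the dual constraints. Such a `Z` splits into rank one pieces made of pairs with
`jω x = A x + B w`, the eigenvectors of a skew-symmetric matrix. -/
theorem eq_zero_of_dual_feasible {A : Matrix ι ι ℝ} {B : Matrix ι κ ℝ} {C : Matrix ν ι ℝ} {γ : ℝ}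
    (hγ : 0 < γ)
    (hfreq : ∀ (ω : ℝ) (x : ι → ℂ) (w : κ → ℂ), A.map Complex.ofReal *ᵥ x +
      B.map Complex.ofReal *ᵥ w = (Complex.I * ω) • x → (x ≠ 0 ∨ w ≠ 0) →
      sqNorm (C.map Complex.ofReal *ᵥ x) < γ ^ 2 * sqNorm w)
    {Z : Matrix (ι ⊕ κ) (ι ⊕ κ) ℝ} (hZ : Z.PosSemidef)
    (hskew : A * Z.toBlocks₁₁ + B * Z.toBlocks₁₂ᵀ + (A * Z.toBlocks₁₁ + B * Z.toBlocks₁₂ᵀ)ᵀ = 0)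
    (htr : γ ^ 2 * Z.toBlocks₂₂.trace ≤ (C * Z.toBlocks₁₁ * Cᵀ).trace) : Z = 0 := by
  obtain ⟨Q, d, N, hQ1, hQ2, h11, h12, hN0, hNtr⟩ := hZ.exists_block_factor
  set V := Q * diagonal d with hV
  obtain ⟨G, hG, hYG⟩ : ∃ G : Matrix ι ι ℝ, Gᵀ = -G ∧ A * V + B * Nᵀ = V * G := by
    refine exists_skew_factor hQ1 hQ2 ?_ ?_
    · rw [← hskew, h11, h12]
      simp only [Matrix.add_mul, transpose_add, transpose_mul, Matrix.mul_add, ← hV,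
        transpose_transpose, Matrix.mul_assoc]
    · intro j hj i
      have hBN : (B * Nᵀ) i j = 0 := by simp [mul_apply, hN0 j hj]
      rw [Matrix.add_apply, hBN, hV, ← Matrix.mul_assoc, mul_diagonal, hj, mul_zero, add_zero]
  have hH : (Complex.I • G.map Complex.ofReal).IsHermitian := by
    rw [IsHermitian, conjTranspose_smul, conjTranspose_map_ofReal, hG]
    ext i j
    simp
  obtain ⟨U, hU⟩ : ∃ U : Matrix ι ι ℂ, U = hH.eigenvectorUnitary := ⟨_, rfl⟩
  have hUU : U * Uᴴ = 1 := by rw [hU]; exact Unitary.coe_mul_star_self hH.eigenvectorUnitary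
  have hGu (j : ι) : G.map Complex.ofReal *ᵥ U.col j =
      (Complex.I * ((-hH.eigenvalues j : ℝ) : ℂ)) • U.col j := by
    have h1 : (Complex.I • G.map Complex.ofReal) *ᵥ U.col j = hH.eigenvalues j • U.col j := by
      rw [hU, hH.eigenvectorUnitary_col_eq]
      exact hH.mulVec_eigenvectorBasis j
    rw [smul_mulVec] at h1
    have h2 := congrArg (fun v => (-Complex.I) • v) h1
    simp only [smul_smul] at h2
    ext i
    have h3 := congrFun h2 i
    simp at h3 ⊢
    rw [h3]
    ring
  set x : ι → ι → ℂ := fun j => V.map Complex.ofReal *ᵥ U.col j with hx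
  set w : ι → κ → ℂ := fun j => Nᵀ.map Complex.ofReal *ᵥ U.col j with hw
  have hrel (j : ι) : A.map Complex.ofReal *ᵥ x j + B.map Complex.ofReal *ᵥ w j =
      (Complex.I * ((-hH.eigenvalues j : ℝ) : ℂ)) • x j := by
    have : (A * V + B * Nᵀ).map Complex.ofReal =
        (A * V).map Complex.ofReal + (B * Nᵀ).map Complex.ofReal := by ext; simp
    rw [hx, hw]
    dsimp only
    rw [mulVec_mulVec, mulVec_mulVec, ← add_mulVec, ← map_ofReal_mul, ← map_ofReal_mul, ← this,
      hYG, map_ofReal_mul, ← mulVec_mulVec, hGu, mulVec_smul]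
  have hCx : ∑ j, sqNorm (C.map Complex.ofReal *ᵥ x j) = (C * Z.toBlocks₁₁ * Cᵀ).trace := by
    have := sum_sqNorm_mulVec_col hUU (C * V)
    simp only [map_ofReal_mul, ← mulVec_mulVec] at this
    rw [this, transpose_mul, h11]
    simp only [Matrix.mul_assoc]
  have hwN : ∑ j, sqNorm (w j) = (Nᵀ * N).trace := by
    have := sum_sqNorm_mulVec_col hUU Nᵀ
    rwa [transpose_transpose] at this
  have hterm (j : ι) : 0 ≤ γ ^ 2 * sqNorm (w j) - sqNorm (C.map Complex.ofReal *ᵥ x j) := by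
    by_cases h0 : x j ≠ 0 ∨ w j ≠ 0
    · linarith [hfreq _ _ _ (hrel j) h0]
    · push Not at h0
      simp [h0.1, h0.2, sqNorm]
  have hsum : ∑ j, (γ ^ 2 * sqNorm (w j) - sqNorm (C.map Complex.ofReal *ᵥ x j)) = 0 := by
    refine le_antisymm ?_ (Finset.sum_nonneg fun j _ => hterm j)
    rw [Finset.sum_sub_distrib, ← Finset.mul_sum, hCx, hwN]
    have := mul_le_mul_of_nonneg_left hNtr (sq_nonneg γ)
    linarith
  have hx0 (j : ι) : x j = 0 := by
    by_contra h0
    have h1 := (Finset.sum_eq_zero_iff_of_nonneg fun j _ => hterm j).1 hsum j (Finset.mem_univ j)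
    linarith [hfreq _ _ _ (hrel j) (Or.inl h0)]
  have h11tr : Z.toBlocks₁₁.trace = 0 := by
    rw [h11, ← sum_sqNorm_mulVec_col hUU V]
    exact Finset.sum_eq_zero fun j _ => sqNorm_eq_zero.2 (hx0 j)
  have h11z : Z.toBlocks₁₁ = 0 := (hZ.submatrix Sum.inl).trace_eq_zero_iff.1 h11tr
  have h22 : Z.toBlocks₂₂.trace ≤ 0 := by
    rw [h11z, Matrix.mul_zero, Matrix.zero_mul, trace_zero] at htr
    exact nonpos_of_mul_nonpos_right htr (by positivity)
  refine hZ.trace_eq_zero_iff.1 (le_antisymm ?_ hZ.trace_nonneg)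
  have : Z.trace = Z.toBlocks₁₁.trace + Z.toBlocks₂₂.trace := Fintype.sum_sum_type _
  linarith

end duality

/-! ### Separation and the strict bounded real lemma -/

/-- The matrices of negative definite, not necessarily symmetric, forms. They form an open convex
cone in the space of all matrices. -/
def negDefForms (ι : Type*) [Fintype ι] : Set (Matrix ι ι ℝ) :=
  {N | ∀ v ≠ 0, v ⬝ᵥ N *ᵥ v < 0}

section negDefForms
variable {ι : Type*} [Fintype ι]

theorem smul_mem_negDefForms {N : Matrix ι ι ℝ} (hN : N ∈ negDefForms ι) {c : ℝ} (hc : 0 < c) :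
    c • N ∈ negDefForms ι := fun v hv => by
  rw [smul_mulVec, dotProduct_smul]
  exact smul_neg_of_pos_of_neg hc (hN v hv)

theorem convex_negDefForms : Convex ℝ (negDefForms ι) := by
  intro N hN M hM a b ha hb hab v hv
  have h1 := hN v hv
  have h2 := hM v hv
  rw [add_mulVec, smul_mulVec, smul_mulVec, dotProduct_add, dotProduct_smul, dotProduct_smul,
    smul_eq_mul, smul_eq_mul]
  rcases ha.eq_or_lt with rfl | ha'
  · obtain rfl : b = 1 := by linarith
    linarith
  · nlinarith

theorem isOpen_negDefForms : IsOpen (negDefForms ι) := by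
  have hs : negDefForms ι = {N | ∀ v ∈ Metric.sphere (0 : ι → ℝ) 1, v ⬝ᵥ N *ᵥ v < 0} := by
    ext N
    refine ⟨fun h v hv => h v fun h0 => by simp [h0] at hv, fun h v hv => ?_⟩
    have hn : 0 < ‖v‖ := norm_pos_iff.2 hv
    have h1 := h (‖v‖⁻¹ • v) (by simp [norm_smul, hn.ne'])
    rw [mulVec_smul, dotProduct_smul, smul_dotProduct, smul_eq_mul, smul_eq_mul, ← mul_assoc] at h1
    exact neg_of_mul_neg_right h1 (by positivity)
  rw [hs, isOpen_iff_mem_nhds]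
  intro N hN
  refine (isCompact_sphere (0 : ι → ℝ) 1).eventually_forall_of_forall_eventually fun v hv => ?_
  have hc : Continuous fun z : Matrix ι ι ℝ × (ι → ℝ) => z.2 ⬝ᵥ z.1 *ᵥ z.2 := by fun_prop
  exact hc.continuousAt.eventually_lt_const (hN v hv)

theorem add_mem_negDefForms {N K : Matrix ι ι ℝ} (hN : N ∈ negDefForms ι)
    (hK : ∀ v, v ⬝ᵥ K *ᵥ v ≤ 0) : N + K ∈ negDefForms ι := fun v hv => by
  rw [add_mulVec, dotProduct_add]
  exact add_neg_of_neg_of_nonpos (hN v hv) (hK v)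

theorem neg_one_mem_negDefForms [DecidableEq ι] : (-1 : Matrix ι ι ℝ) ∈ negDefForms ι :=
  fun v hv => by
  rw [neg_mulVec, one_mulVec, dotProduct_neg, neg_lt_zero]
  exact (Finset.sum_nonneg fun i _ => mul_self_nonneg (v i)).lt_of_ne'
    (dotProduct_self_eq_zero.not.2 hv)

/-- A linear functional that is bounded above on the negative definite forms is the pairing
`N ↦ tr (Z N)` with a positive semidefinite `Z`. -/
theorem exists_posSemidef_of_bddAbove_negDefForms [DecidableEq ι]
    (f : Matrix ι ι ℝ →ₗ[ℝ] ℝ) {u : ℝ} (hf : ∀ N ∈ negDefForms ι, f N < u) :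
    0 ≤ u ∧ ∃ Z : Matrix ι ι ℝ, Z.PosSemidef ∧ ∀ N, f N = (Z * N).trace := by
  have hle (N : Matrix ι ι ℝ) (hN : N ∈ negDefForms ι) : f N ≤ 0 := by
    by_contra! h
    have hu : 0 < u := h.trans (hf N hN)
    have := hf _ (smul_mem_negDefForms hN (div_pos hu h))
    rw [map_smul, smul_eq_mul, div_mul_cancel₀ _ h.ne'] at this
    exact this.false
  have hu : 0 ≤ u := by
    refine le_of_forall_pos_lt_add fun ε hε => ?_
    set a := f (-1 : Matrix ι ι ℝ) with ha
    have hc : 0 < ε / (|a| + 1) := by positivity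
    have := hf _ (smul_mem_negDefForms neg_one_mem_negDefForms hc)
    rw [map_smul, smul_eq_mul, ← ha] at this
    have h2 : -ε < ε / (|a| + 1) * a := by
      rw [div_mul_eq_mul_div, lt_div_iff₀ (by positivity)]
      nlinarith [neg_abs_le a]
    linarith
  -- Adding multiples of a form with nonpositive values keeps a form negative definite.
  have hcone (K : Matrix ι ι ℝ) (hK : ∀ v, v ⬝ᵥ K *ᵥ v ≤ 0) : f K ≤ 0 := by
    by_contra! h
    set a := f (-1 : Matrix ι ι ℝ) with ha
    have := hle _ (add_mem_negDefForms (K := (((|a| + 1) / f K) • K)) neg_one_mem_negDefForms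
      fun v => by
        rw [smul_mulVec, dotProduct_smul]
        exact smul_nonpos_of_nonneg_of_nonpos (by positivity) (hK v))
    rw [map_add, map_smul, smul_eq_mul, ← ha, div_mul_cancel₀ _ h.ne'] at this
    linarith [neg_abs_le a]
  have hsymm (i j : ι) : f (single i j 1) = f (single j i 1) := by
    have h (i j : ι) : f (single i j 1 - single j i 1) ≤ 0 := hcone _ fun v => by
      rw [sub_mulVec, dotProduct_sub]
      have e (i j : ι) : v ⬝ᵥ single i j (1 : ℝ) *ᵥ v = v i * v j := by
        rw [single_mulVec, one_mul, ← Pi.single, dotProduct_single]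
      rw [e, e, mul_comm, sub_self]
    have h1 := h i j
    have h2 := h j i
    rw [map_sub] at h1 h2
    linarith
  have hrep (N : Matrix ι ι ℝ) : f N = ((of fun i j => f (single i j 1)) * N).trace := by
    conv_lhs => rw [matrix_eq_sum_single N]
    simp only [map_sum, trace, diag_apply, mul_apply, of_apply]
    rw [Finset.sum_comm]
    refine Finset.sum_congr rfl fun i _ => Finset.sum_congr rfl fun j _ => ?_
    have : single j i (N j i) = N j i • single j i (1 : ℝ) := by
      rw [smul_single, smul_eq_mul, mul_one]
    rw [this, map_smul, smul_eq_mul, hsymm, mul_comm]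
  refine ⟨hu, _, PosSemidef.of_dotProduct_mulVec_nonneg ?_ fun v => ?_, hrep⟩
  · ext i j
    exact hsymm j i
  · have h1 := hcone (-vecMulVec v v) fun v' => by
      rw [neg_mulVec, dotProduct_neg, vecMulVec_mulVec]
      simp [dotProduct_comm v' v, mul_self_nonneg]
    rw [map_neg, neg_nonpos, hrep, mul_vecMulVec, trace_vecMulVec, dotProduct_comm] at h1
    exact h1

end negDefForms

section kyp
variable {ι κ ν : Type*} [Fintype ι] [Fintype κ] [Fintype ν] [DecidableEq ι] [DecidableEq κ]

/-- The strict bounded real lemma (Kalman–Yakubovich–Popov). If no symmetric `P` existed, the affine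
space of all such forms would miss the open convex cone of negative definite forms, and a separating
hyperplane would be a nonzero solution of the dual problem. -/
theorem exists_storage_of_freq_lt {A : Matrix ι ι ℝ} {B : Matrix ι κ ℝ} {C : Matrix ν ι ℝ} {γ : ℝ}
    (hγ : 0 < γ)
    (hfreq : ∀ (ω : ℝ) (x : ι → ℂ) (w : κ → ℂ), A.map Complex.ofReal *ᵥ x +
      B.map Complex.ofReal *ᵥ w = (Complex.I * ω) • x → (x ≠ 0 ∨ w ≠ 0) →
      sqNorm (C.map Complex.ofReal *ᵥ x) < γ ^ 2 * sqNorm w) :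
    ∃ P : Matrix ι ι ℝ, Pᵀ = P ∧ ∀ (x : ι → ℝ) (w : κ → ℝ), (x ≠ 0 ∨ w ≠ 0) →
      (C *ᵥ x) ⬝ᵥ (C *ᵥ x) - γ ^ 2 * (w ⬝ᵥ w) + 2 * (x ⬝ᵥ P *ᵥ (A *ᵥ x + B *ᵥ w)) < 0 := by
  -- The form is represented by nonsymmetric matrices, linearly in an unrestricted `P` that stands
  -- for its symmetric part.
  set F : Matrix ι ι ℝ → Matrix (ι ⊕ κ) (ι ⊕ κ) ℝ := fun P =>
    fromBlocks (Cᵀ * C) 0 0 (-(γ ^ 2) • 1) + fromBlocks ((P + Pᵀ) * A) ((P + Pᵀ) * B) 0 0 with hF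
  by_cases hex : ∃ P, F P ∈ negDefForms (ι ⊕ κ)
  · obtain ⟨P, hP⟩ := hex
    refine ⟨(1 / 2 : ℝ) • (P + Pᵀ), by simp [add_comm], fun x w hxw => ?_⟩
    have h := hP (Sum.elim x w) (by
      rintro h0
      rcases hxw with h | h
      · exact h (funext fun i => congrFun h0 (Sum.inl i))
      · exact h (funext fun i => congrFun h0 (Sum.inr i)))
    simp only [hF, add_mulVec, fromBlocks_mulVec, dotProduct_add] at h
    have e1 : x ⬝ᵥ (Cᵀ * C) *ᵥ x = (C *ᵥ x) ⬝ᵥ (C *ᵥ x) := by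
      rw [← mulVec_mulVec, dotProduct_mulVec, vecMul_transpose]
    simp only [Sum.elim_comp_inl, Sum.elim_comp_inr, sumElim_dotProduct_sumElim, zero_mulVec,
      add_zero, zero_add, dotProduct_zero, smul_mulVec, one_mulVec, dotProduct_smul, e1,
      smul_eq_mul, dotProduct_add] at h
    simp only [mulVec_add, dotProduct_add, mulVec_mulVec, Matrix.smul_mul, smul_mulVec,
      dotProduct_smul, smul_eq_mul]
    simp only [Matrix.add_mul, add_mulVec, dotProduct_add] at h ⊢
    linarith
  exfalso
  have hconv : Convex ℝ (Set.range F) := by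
    rintro _ ⟨P, rfl⟩ _ ⟨P', rfl⟩ a b ha hb hab
    refine ⟨a • P + b • P', ?_⟩
    obtain rfl : b = 1 - a := by linarith
    simp only [hF, fromBlocks_add, fromBlocks_smul]
    congr 1
    · simp only [transpose_add, transpose_smul, Matrix.add_mul, Matrix.smul_mul]
      module
    · simp only [transpose_add, transpose_smul, Matrix.add_mul, Matrix.smul_mul]
      module
    · simp
    · module
  obtain ⟨f, u, hf1, hf2⟩ := geometric_hahn_banach_open convex_negDefForms isOpen_negDefForms hconv
    (Set.disjoint_left.2 fun N hN ⟨P, hP⟩ => hex ⟨P, hP ▸ hN⟩)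
  obtain ⟨hu, Z, hZ, hfZ⟩ := exists_posSemidef_of_bddAbove_negDefForms f.toLinearMap hf1
  have hfZ' (N) : f N = (Z * N).trace := hfZ N
  have h21 : Z.toBlocks₂₁ = Z.toBlocks₁₂ᵀ := by
    ext i j
    exact (hZ.isHermitian.apply (Sum.inr i) (Sum.inl j)).symm
  set Y := A * Z.toBlocks₁₁ + B * Z.toBlocks₁₂ᵀ with hY
  have hfF (P : Matrix ι ι ℝ) : f (F P) =
      (C * Z.toBlocks₁₁ * Cᵀ).trace - γ ^ 2 * Z.toBlocks₂₂.trace + (P * (Y + Yᵀ)).trace := by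
    have htr (M : Matrix (ι ⊕ κ) (ι ⊕ κ) ℝ) : M.trace = M.toBlocks₁₁.trace + M.toBlocks₂₂.trace :=
      Fintype.sum_sum_type _
    have e1 : (Z.toBlocks₁₁ * (Cᵀ * C)).trace = (C * Z.toBlocks₁₁ * Cᵀ).trace := by
      rw [← Matrix.mul_assoc, trace_mul_comm, Matrix.mul_assoc]
    have e2 : (Z.toBlocks₁₁ * ((P + Pᵀ) * A)).trace = ((P + Pᵀ) * (A * Z.toBlocks₁₁)).trace := by
      rw [trace_mul_comm, Matrix.mul_assoc]
    have e3 : (Z.toBlocks₁₂ᵀ * ((P + Pᵀ) * B)).trace = ((P + Pᵀ) * (B * Z.toBlocks₁₂ᵀ)).trace := by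
      rw [trace_mul_comm, Matrix.mul_assoc]
    have e4 : (Pᵀ * Y).trace = (P * Yᵀ).trace := by
      rw [← trace_transpose, transpose_mul, transpose_transpose, trace_mul_comm]
    have e5 : (P * (Y + Yᵀ)).trace = ((P + Pᵀ) * Y).trace := by
      rw [Matrix.mul_add, Matrix.add_mul, trace_add, trace_add, e4]
    rw [e5, hfZ', hF]
    dsimp only
    rw [fromBlocks_add]
    nth_rewrite 1 [← fromBlocks_toBlocks Z]
    rw [fromBlocks_multiply, htr, toBlocks_fromBlocks₁₁, toBlocks_fromBlocks₂₂, h21]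
    simp only [Matrix.mul_add, trace_add, add_zero, Matrix.mul_zero, zero_add, e1, e2, e3, hY,
      Matrix.mul_smul, trace_smul, Matrix.mul_one, smul_eq_mul]
    ring
  have hskew : Y + Yᵀ = 0 := by
    have hsym : (Y + Yᵀ)ᵀ = Y + Yᵀ := by rw [transpose_add, transpose_transpose, add_comm]
    rw [← trace_mul_conjTranspose_self_eq_zero_iff, conjTranspose_eq_transpose_of_trivial, hsym]
    set b := ((Y + Yᵀ) * (Y + Yᵀ)).trace with hb
    set a := (C * Z.toBlocks₁₁ * Cᵀ).trace - γ ^ 2 * Z.toBlocks₂₂.trace with ha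
    by_contra hb0
    have h := hf2 _ ⟨((u - a - 1) / b) • (Y + Yᵀ), rfl⟩
    rw [hfF, Matrix.smul_mul, trace_smul, ← hb, smul_eq_mul, div_mul_cancel₀ _ hb0] at h
    linarith
  have hZ0 : Z = 0 := by
    refine eq_zero_of_dual_feasible hγ hfreq hZ hskew ?_
    have h := hf2 _ ⟨0, rfl⟩
    rw [hfF, Matrix.zero_mul, trace_zero] at h
    linarith
  have h1 := hf1 _ neg_one_mem_negDefForms
  have h2 := hf2 _ ⟨0, rfl⟩
  rw [hfZ', hZ0, Matrix.zero_mul, trace_zero] at h1 h2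
  linarith

end kyp

/-! ### Equality of the optimal values -/

/-- The strict bounded real lemma for a Hurwitz matrix, as solvability of the Riccati inequality.
The control `w = γ⁻² Bᵀ P x` turns the storage inequality into the Riccati one, and `w = 0` turns it
into a Lyapunov inequality, whence `P ≻ 0`. -/
theorem IsHurwitz.exists_riccatiLE {n : ℕ} {κ ν : Type*} [Fintype κ] [Fintype ν] [DecidableEq κ]
    {A : Matrix (Fin n) (Fin n) ℝ} {B : Matrix (Fin n) κ ℝ} {C : Matrix ν (Fin n) ℝ} {γ : ℝ}
    (hA : IsHurwitz A) (hγ : 0 < γ)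
    (hfreq : ∀ (ω : ℝ) (x : Fin n → ℂ) (w : κ → ℂ), A.map Complex.ofReal *ᵥ x +
      B.map Complex.ofReal *ᵥ w = (Complex.I * ω) • x → w ≠ 0 →
      sqNorm (C.map Complex.ofReal *ᵥ x) < γ ^ 2 * sqNorm w) :
    ∃ P : Matrix (Fin n) (Fin n) ℝ, P.PosDef ∧ RiccatiLE P A B C (γ ^ 2)⁻¹ := by
  obtain ⟨P, hP, hlt⟩ := exists_storage_of_freq_lt hγ fun ω x w h hxw => by
    refine hfreq ω x w h fun hw => ?_
    rw [hw, mulVec_zero, add_zero] at h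
    have := hA _ ((mem_spectrum_iff_exists_mulVec _ _).2 ⟨x, hxw.resolve_right (not_not.2 hw), h⟩)
    simp at this
  refine ⟨P, hA.posDef_of_lyapunov hP fun x hx => ?_, ?_⟩
  · have h := hlt x 0 (Or.inl hx)
    simp only [mulVec_zero, add_zero, dotProduct_zero, mul_zero, sub_zero] at h
    have : 0 ≤ (C *ᵥ x) ⬝ᵥ (C *ᵥ x) := Finset.sum_nonneg fun i _ => mul_self_nonneg _
    linarith
  · have hsymm : (P * A + Aᵀ * P + Cᵀ * C + (γ ^ 2)⁻¹ • (P * B * Bᵀ * P)).IsHermitian := by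
      rw [IsHermitian, conjTranspose_eq_transpose_of_trivial]
      simp only [transpose_add, transpose_mul, transpose_smul, transpose_transpose, hP,
        Matrix.mul_assoc]
      abel
    refine PosSemidef.of_dotProduct_mulVec_nonneg hsymm.neg fun x => ?_
    rcases eq_or_ne x 0 with rfl | hx
    · simp
    set b := Bᵀ *ᵥ (P *ᵥ x) with hb
    have h := hlt x ((γ ^ 2)⁻¹ • b) (Or.inl hx)
    have e1 : x ⬝ᵥ (P * A) *ᵥ x = x ⬝ᵥ P *ᵥ (A *ᵥ x) := by rw [mulVec_mulVec]
    have e2 : x ⬝ᵥ (Aᵀ * P) *ᵥ x = x ⬝ᵥ P *ᵥ (A *ᵥ x) := by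
      rw [← mulVec_mulVec, dotProduct_mulVec, vecMul_transpose, dotProduct_mulVec x P,
        ← mulVec_transpose, hP, dotProduct_comm]
    have e3 : x ⬝ᵥ (Cᵀ * C) *ᵥ x = (C *ᵥ x) ⬝ᵥ (C *ᵥ x) := by
      rw [← mulVec_mulVec, dotProduct_mulVec, vecMul_transpose]
    have e4 (v : κ → ℝ) : x ⬝ᵥ P *ᵥ (B *ᵥ v) = b ⬝ᵥ v := by
      rw [hb, dotProduct_mulVec, dotProduct_mulVec, ← mulVec_transpose P, hP,
        ← mulVec_transpose B]
    have e5 : x ⬝ᵥ (P * B * Bᵀ * P) *ᵥ x = b ⬝ᵥ b := by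
      rw [← e4, hb, mulVec_mulVec, mulVec_mulVec, mulVec_mulVec, Matrix.mul_assoc,
        Matrix.mul_assoc]
    rw [mulVec_add, dotProduct_add, e4, dotProduct_smul, dotProduct_smul, smul_dotProduct] at h
    rw [star_trivial, neg_mulVec, dotProduct_neg, add_mulVec, add_mulVec, add_mulVec, smul_mulVec,
      dotProduct_add, dotProduct_add, dotProduct_add, dotProduct_smul, e1, e2, e3, e5]
    simp only [smul_eq_mul] at h ⊢
    rw [← mul_assoc (γ ^ 2), mul_inv_cancel₀ (by positivity), one_mul] at h
    linarith

namespace LTISystem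
variable {n m l q : ℕ}

/-- The positive semidefinite matrix `[1; K] W₁ [1, Kᵀ]` generates the gain `K`. -/
theorem posSemidef_fromBlocks_gain {W₁ : Matrix (Fin n) (Fin n) ℝ} (hW : W₁.PosDef)
    (K : Matrix (Fin m) (Fin n) ℝ) :
    (fromBlocks W₁ (W₁ * Kᵀ) (K * W₁) (K * W₁ * Kᵀ)).PosSemidef := by
  have h := hW.posSemidef.mul_mul_conjTranspose_same (fromRows (1 : Matrix (Fin n) (Fin n) ℝ) K)
  rw [conjTranspose_eq_transpose_of_trivial, transpose_fromRows, fromRows_mul,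
    fromRows_mul_fromCols] at h
  simpa using h

/-- Every bound above the `H∞`-norm of a stabilizing gain is realized by a point of `𝒞`. -/
theorem IsStabilizing.exists_mem_paramSet {S : LTISystem n m l q} {K : Matrix (Fin m) (Fin n) ℝ}
    (hK : S.IsStabilizing K) (hCD : S.Cᵀ * S.D = 0) {γ : ℝ} (hγ : 0 < γ)
    (h : S.hInfNorm K < ENNReal.ofReal γ) :
    ∃ W, (W, (γ ^ 2)⁻¹) ∈ S.paramSet := by
  obtain ⟨P, hP, hR⟩ := IsHurwitz.exists_riccatiLE (B := S.B₁) (C := S.closedLoopC K) hK hγ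
    fun ω x w hx hw => by
      rw [hK.mulVec_add_mulVec] at hx
      rw [hx, ← transferFunction_mulVec]
      have h1 : maxSingularValue (S.transferFunction K (Complex.I * ω)) < γ := by
        refine (ENNReal.ofReal_lt_ofReal_iff hγ).1 (lt_of_le_of_lt ?_ h)
        exact le_iSup (fun ω : ℝ =>
          ENNReal.ofReal (maxSingularValue (S.transferFunction K (Complex.I * (ω : ℂ))))) ω
      refine (sqNorm_mulVec_le _ w).trans_lt (mul_lt_mul_of_pos_right ?_ (sqNorm_pos hw))
      exact pow_lt_pow_left₀ h1 (norm_nonneg _) two_ne_zero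
  refine ⟨fromBlocks P⁻¹ (P⁻¹ * Kᵀ) (K * P⁻¹) (K * P⁻¹ * Kᵀ),
    posSemidef_fromBlocks_gain hP.inv K, ?_, ?_, ?_⟩
  · simpa using hP.inv
  · have hu := (Matrix.isUnit_iff_isUnit_det _).1 hP.isUnit
    change (-(S.theta₁ (fromBlocks _ _ _ _) _)).PosSemidef
    rw [S.theta₁_fromBlocks hCD, ← riccatiLE_inv_iff hP.inv, nonsing_inv_nonsing_inv _ hu]
    exact hR
  · change 0 < (γ ^ 2)⁻¹
    positivity

/-- `1 / √μ` over `𝒞` and the `H∞`-norm over the stabilizing gains have the same infimum. -/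
theorem optimalHInfValue_eq_iInf (S : LTISystem n m l q) (hobs : IsObservablePair S.A S.C)
    (hCD : S.Cᵀ * S.D = 0) (hDD : (S.Dᵀ * S.D).PosDef) :
    S.optimalHInfValue = ⨅ p ∈ S.paramSet, ENNReal.ofReal (1 / Real.sqrt p.2) := by
  refine le_antisymm (le_iInf₂ fun p hp => ?_) (le_iInf₂ fun K hK => ?_)
  · have h := S.isStabilizing_and_hInfNorm_le hobs hCD hDD (W := p.1) (μ := p.2) hp
    exact (iInf₂_le _ h.1).trans h.2
  · refine le_of_forall_gt_imp_ge_of_dense fun c hc => ?_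
    rcases eq_or_ne c ∞ with rfl | hc'
    · exact le_top
    have hγ : 0 < c.toReal := ENNReal.toReal_pos (ne_bot_of_gt hc) hc'
    obtain ⟨W, hW⟩ := hK.exists_mem_paramSet hCD hγ (by rwa [ENNReal.ofReal_toReal hc'])
    refine (iInf₂_le _ hW).trans (le_of_eq ?_)
    rw [Real.sqrt_inv, Real.sqrt_sq hγ.le, one_div, inv_inv, ENNReal.ofReal_toReal hc']

end LTISystem

theorem theorem1 {n m l q : ℕ} (S : LTISystem n m l q)
    (hobs : IsObservablePair S.A S.C)
    (hCD : S.Cᵀ * S.D = 0)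
    (hDD : (S.Dᵀ * S.D).PosDef) :
    -- (a) the parameter set is convex
    Convex ℝ S.paramSet ∧
    -- (b) each of its points generates a stabilizing gain with attenuation `1 / √μ`
    (∀ (W : Matrix (Fin n ⊕ Fin m) (Fin n ⊕ Fin m) ℝ) (μ : ℝ), (W, μ) ∈ S.paramSet →
      S.IsStabilizing (gainOf W) ∧
      S.hInfNorm (gainOf W) ≤ ENNReal.ofReal (1 / Real.sqrt μ)) ∧
    -- (c) a maximizer of `μ` gives an optimal gain and the optimal norm
    (∀ (W : Matrix (Fin n ⊕ Fin m) (Fin n ⊕ Fin m) ℝ) (μ : ℝ), (W, μ) ∈ S.paramSet →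
      (∀ p ∈ S.paramSet, p.2 ≤ μ) →
      S.IsOptimalHInfGain (gainOf W) ∧
      S.hInfNorm (gainOf W) = ENNReal.ofReal (1 / Real.sqrt μ) ∧
      S.optimalHInfValue = ENNReal.ofReal (1 / Real.sqrt μ)) ∧
    -- (c) attained or not, the two optimization problems have the same optimal value
    S.optimalHInfValue = ⨅ p ∈ S.paramSet, ENNReal.ofReal (1 / Real.sqrt p.2) := by
  have hval := S.optimalHInfValue_eq_iInf hobs hCD hDD
  refine ⟨S.convex_paramSet, fun W μ h => S.isStabilizing_and_hInfNorm_le hobs hCD hDD h,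
    fun W μ h hmax => ?_, hval⟩
  obtain ⟨hstab, hle⟩ := S.isStabilizing_and_hInfNorm_le hobs hCD hDD h
  have hopt : S.optimalHInfValue = ENNReal.ofReal (1 / Real.sqrt μ) := by
    rw [hval]
    refine le_antisymm (iInf₂_le (W, μ) h) (le_iInf₂ fun p hp => ENNReal.ofReal_le_ofReal ?_)
    exact one_div_le_one_div_of_le (Real.sqrt_pos.2 hp.2.2.2) (Real.sqrt_le_sqrt (hmax p hp))
  have hmin (K) (hK : S.IsStabilizing K) : S.optimalHInfValue ≤ S.hInfNorm K := iInf₂_le K hK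
  exact ⟨⟨hstab, fun K hK => (hle.trans_eq hopt.symm).trans (hmin K hK)⟩,
    hle.antisymm (hopt ▸ hmin _ hstab), hopt⟩
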